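/- Let $H_{n,k}$ be the complete $k$-uniform hypergraph on $n$ vertices. In the $(1:b)$ Minimum Degree Game with target $m$, where $b\ge 0$ and $m\ge 0$ are integers, the edges of $H_{n,k}$ are claimed in rounds: in each round Maker first claims one unclaimed edge and then Breaker claims $b$ unclaimed edges (all remaining ones if fewer than $b$ are left), until all edges are claimed. Maker's aim is that at the end every vertex lies in at least $m$ of her edges; Breaker's aim is to prevent this. A player "wins" if that player has a winning strategy. Fix $k\ge 2$, put $N=\binom{n}{k-1}$, and let $m=m(n)$ be a sequence of non-negative integers. (i) Suppose $m=o(\log n)$, and let $\varepsilon>0$ be fixed. Then there is $n_0$ such that for all $n\ge n_0$ and every integer $b=\frac{\beta N}{\log n}\ge 0$: Maker wins if $\beta\le 1-\varepsilon$, and Breaker wins if $\beta\ge 1+\varepsilon$ and $m(n)\ge 1$. (ii) Suppose $m=\Omega(\log n)$, and let $\gamma<1$ be fixed. Then there is $n_0$ such that for all $n\ge n_0$ and every integer $b\ge 1$ with $b\le \frac{\gamma N}{km+\log n}$, Maker wins. -/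

import Mathlib

open Filter Asymptotics

/-- `MakerWinsFrom b W F M`: Maker, who is to move, has a winning strategy in the biased `(1 : b)`
Maker-Breaker game when `F` is the set of free elements of the board, `M` is the set of elements
that Maker already owns, and Maker's aim is to own, at the end of the game, a set satisfying `W`.
In one round Maker claims one free element and then Breaker claims `b` free elements (all of them
if fewer than `b` are left); the game ends when the board is exhausted. -/
inductive MakerWinsFrom {α : Type} [DecidableEq α] (b : ℕ) (W : Finset α → Prop) :
    Finset α → Finset α → Prop
  | finish {M : Finset α} (hW : W M) : MakerWinsFrom b W ∅ M
  | round {F M : Finset α} (e : α) (he : e ∈ F)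
      (h : ∀ S : Finset α, S ⊆ F.erase e → S.card = min b (F.erase e).card →
        MakerWinsFrom b W (F.erase e \ S) (insert e M)) :
      MakerWinsFrom b W F M

/-- `BreakerWinsFrom b W F M`: in the same game, in the same position (Maker is to move), Breaker
has a winning strategy, i.e. he can ensure that the set owned by Maker at the end does not
satisfy `W`. Here `R e` is Breaker's reply when Maker claims `e`. -/
inductive BreakerWinsFrom {α : Type} [DecidableEq α] (b : ℕ) (W : Finset α → Prop) :
    Finset α → Finset α → Prop
  | finish {M : Finset α} (hW : ¬ W M) : BreakerWinsFrom b W ∅ M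
  | round {F M : Finset α} (hF : F.Nonempty) (R : α → Finset α)
      (hR : ∀ e ∈ F, R e ⊆ F.erase e ∧ (R e).card = min b (F.erase e).card)
      (h : ∀ e ∈ F, BreakerWinsFrom b W (F.erase e \ R e) (insert e M)) :
      BreakerWinsFrom b W F M

/-- The edge set of the complete `k`-uniform hypergraph on the vertex set `Fin n`. -/
def completeHypergraph (n k : ℕ) : Finset (Finset (Fin n)) :=
  Finset.powersetCard k Finset.univ

/-- The degree of `v` in the hypergraph with edge set `E`: the number of edges containing `v`. -/
def hyperDegree {n : ℕ} (E : Finset (Finset (Fin n))) (v : Fin n) : ℕ :=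
  (E.filter (fun e => v ∈ e)).card

/-- The hypergraph with edge set `E` has minimum degree at least `m`. -/
def HasMinDegree {n : ℕ} (m : ℕ) (E : Finset (Finset (Fin n))) : Prop :=
  ∀ v : Fin n, m ≤ hyperDegree E v

/-- Maker wins the `(1 : b)` Minimum Degree Game with target degree `m`, played on the complete
`k`-uniform hypergraph on `n` vertices (Maker moves first). -/
def MakerWinsMinDegree (n k b m : ℕ) : Prop :=
  MakerWinsFrom b (HasMinDegree (n := n) m) (completeHypergraph n k) ∅

/-- Breaker wins the `(1 : b)` Minimum Degree Game with target degree `m`, played on the complete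
`k`-uniform hypergraph on `n` vertices (Maker moves first). -/
def BreakerWinsMinDegree (n k b m : ℕ) : Prop :=
  BreakerWinsFrom b (HasMinDegree (n := n) m) (completeHypergraph n k) ∅

/-!
Write `N = n.choose (k - 1)`, and note that all degrees of the complete hypergraph are `(1 - o(1)) N`
and all codegrees are `O(N / n)`.

**Maker.** It is enough to show that for fixed `δ > 0` and large `n`, uniformly in `m` and `b ≥ 1`,
Maker wins if `b (k m + log n) ≤ (1 - δ) N` (`eventually_makerWinsMinDegree`). This covers (ii), and
also (i), where `k m` is negligible against `log n`; the case `b = 0` is trivial.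

If `b` is at least a small multiple of `N / log n`, Maker plays at a vertex of maximal danger
`d_B(v) - k b d_M(v)` among the active ones, those with `d_M(v) < m`, claiming any free edge there.
Let `J` be a set of active vertices after a round. If the vertex `v` just attended to is in `J`,
then the total danger of `J` has not grown, as Breaker's `b` edges add at most `k b` to it. If not,
then before the round `J` had at most the average danger of `J ∪ {v}`, since `v` was a most dangerous
vertex. So the average danger of `r` active vertices is at most `h r`, where
`h r = h (r + 1) + k b / r`, and this alone gives `k b log n` in place of `b log n`. The factor `k` is
saved for `r ≤ R = η n`: there few edges meet `J` twice. The excess of the degree sum of `J` over the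
number of Breaker's edges meeting `J` (`overlap`) goes up by at most `r c` when a vertex is added
to `J`, where `c` is the maximal codegree, so that up to the overlap the average danger is at most
`g r`, with `g r = g (r + 1) + b / r + c`. As a single vertex has overlap `0`, its danger is at most
`g 1 ≤ b log n + O(b) + O(η N)` (`makerWins_of_danger`).

For smaller `b` that argument is too wasteful, since `m` may be of order `N`. There the exponential
potential `∑ v, (1 + t) ^ (d_B(v) / b) * (1 - t) ^ d_M(v)` does not increase if Maker always claims a
free edge of maximal weight (`sum_vertexWeight_round_le`). It starts at `n`, whereas a vertex with
`d_M(v) < m` at the end would alone contribute `exp (Ω(N / b))`, because `k ≥ 2` and `b ≥ 1` give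
`(b + 1) m ≤ k b m ≤ (1 - δ) N`.

**Breaker.** If `b ≥ (1 + ε) N / log n`, Breaker keeps one vertex isolated in Maker's hypergraph. He
fixes a set of `2 s` vertices with `s` about `n ^ α`, where `α < 1` and `(1 + ε) α > 1`, and claims all
edges with two vertices in it. This takes few rounds, so at least `s` of the vertices remain untouched
by Maker. From then on an edge of Maker touches at most one of the untouched vertices, and Breaker
plays the box game on their stars: when `j` of them are left, he claims `b / j` edges at each. A star
that survives to the end has lost about `∑ b / j ≈ b log s = α b log n > N` edges, so it is exhausted
before Maker can touch its vertex (`breakerWins_of_boxes`).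
-/

/-! ### Strategies from invariants -/

theorem MakerWinsFrom.of_invariant {α : Type} [DecidableEq α] {b : ℕ} {W : Finset α → Prop}
    (I : Finset α → Finset α → Prop) (hend : ∀ M, I ∅ M → W M)
    (hstep : ∀ F M, F.Nonempty → I F M → ∃ e ∈ F, ∀ S : Finset α, S ⊆ F.erase e → S.card ≤ b →
      I (F.erase e \ S) (insert e M)) {F M : Finset α} (h : I F M) : MakerWinsFrom b W F M := by
  induction hc : F.card using Nat.strong_induction_on generalizing F M with
  | _ c ih =>
    obtain rfl | hF := F.eq_empty_or_nonempty
    · exact .finish (hend M h)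
    · obtain ⟨e, he, hS⟩ := hstep F M hF h
      refine .round e he fun S hSF hcard => ?_
      refine ih _ ?_ (hS S hSF (hcard ▸ min_le_left _ _)) rfl
      rw [← hc]
      exact (Finset.card_le_card Finset.sdiff_subset).trans_lt (Finset.card_erase_lt_of_mem he)

/-- It suffices to name a set `S` of at most `b` free elements that Breaker wants in each round,
if the invariant does not mind that he claims further ones. -/
theorem BreakerWinsFrom.of_invariant {α : Type} [DecidableEq α] {b : ℕ} {W : Finset α → Prop}
    (I : Finset α → Finset α → Prop) (hend : ∀ M, I ∅ M → ¬ W M)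
    (hstep : ∀ F M, I F M → ∀ e ∈ F, ∃ S : Finset α, S ⊆ F.erase e ∧ S.card ≤ b ∧
      ∀ T, S ⊆ T → T ⊆ F.erase e → I (F.erase e \ T) (insert e M))
    {F M : Finset α} (h : I F M) : BreakerWinsFrom b W F M := by
  induction hc : F.card using Nat.strong_induction_on generalizing F M with
  | _ c ih =>
    obtain rfl | hF := F.eq_empty_or_nonempty
    · exact .finish (hend M h)
    · have key : ∀ e ∈ F, ∃ T : Finset α, T ⊆ F.erase e ∧ T.card = min b (F.erase e).card ∧
          I (F.erase e \ T) (insert e M) := by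
        intro e he
        obtain ⟨S, hS, hSb, hT⟩ := hstep F M h e he
        obtain ⟨T, hST, hTF, hTc⟩ := Finset.exists_subsuperset_card_eq (n := min b (F.erase e).card)
          hS (le_min hSb (Finset.card_le_card hS)) (min_le_right _ _)
        exact ⟨T, hTF, hTc, hT T hST hTF⟩
      choose! R hR using key
      refine .round hF R (fun e he => ⟨(hR e he).1, (hR e he).2.1⟩) fun e he => ?_
      refine ih _ ?_ (hR e he).2.2 rfl
      rw [← hc]
      exact (Finset.card_le_card Finset.sdiff_subset).trans_lt (Finset.card_erase_lt_of_mem he)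

theorem MakerWinsFrom.of_bias_zero {α : Type} [DecidableEq α] {W : Finset α → Prop}
    {F : Finset α} (h : W F) : MakerWinsFrom 0 W F ∅ := by
  refine MakerWinsFrom.of_invariant (fun F' M => F' ∪ M = F) (fun M hM => ?_) ?_ (by simp)
  · rw [Finset.empty_union] at hM
    rwa [hM]
  · rintro F' M ⟨e, he⟩ rfl
    refine ⟨e, he, fun S _ hS => ?_⟩
    obtain rfl : S = ∅ := by simpa using hS
    rw [Finset.sdiff_empty, Finset.union_insert, ← Finset.insert_union, Finset.insert_erase he]

/-! ### Degrees -/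

section Degrees

variable {n : ℕ}

theorem hyperDegree_union {E E' : Finset (Finset (Fin n))} (h : Disjoint E E') (v : Fin n) :
    hyperDegree (E ∪ E') v = hyperDegree E v + hyperDegree E' v := by
  unfold hyperDegree
  rw [Finset.filter_union, Finset.card_union_of_disjoint (Finset.disjoint_filter_filter h)]

theorem hyperDegree_mono {E E' : Finset (Finset (Fin n))} (h : E ⊆ E') (v : Fin n) :
    hyperDegree E v ≤ hyperDegree E' v :=
  Finset.card_le_card (Finset.filter_subset_filter _ h)

theorem hyperDegree_insert {E : Finset (Finset (Fin n))} {e : Finset (Fin n)} (h : e ∉ E)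
    (v : Fin n) : hyperDegree (insert e E) v = hyperDegree E v + if v ∈ e then 1 else 0 := by
  unfold hyperDegree
  rw [Finset.filter_insert]
  split_ifs
  · rw [Finset.card_insert_of_notMem (by simp [h])]
  · simp

theorem exists_mem_of_hyperDegree_pos {E : Finset (Finset (Fin n))} {v : Fin n}
    (h : 0 < hyperDegree E v) : ∃ e ∈ E, v ∈ e := by
  obtain ⟨e, he⟩ := Finset.card_pos.1 h
  exact ⟨e, Finset.mem_filter.1 he⟩

/-- Double counting of incidences, with a weight on the vertices. -/
theorem sum_hyperDegree_mul (E : Finset (Finset (Fin n))) (J : Finset (Fin n)) (φ : Fin n → ℝ) :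
    ∑ v ∈ J, (hyperDegree E v : ℝ) * φ v = ∑ e ∈ E, ∑ v ∈ e ∩ J, φ v := by
  have h1 : ∀ v ∈ J, (hyperDegree E v : ℝ) * φ v = ∑ e ∈ E, if v ∈ e then φ v else 0 := by
    intro v _
    rw [← Finset.sum_filter, Finset.sum_const, nsmul_eq_mul, hyperDegree]
  rw [Finset.sum_congr rfl h1, Finset.sum_comm]
  refine Finset.sum_congr rfl fun e _ => ?_
  rw [← Finset.sum_filter, Finset.filter_mem_eq_inter, Finset.inter_comm]

theorem sum_hyperDegree (E : Finset (Finset (Fin n))) (J : Finset (Fin n)) :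
    ∑ v ∈ J, hyperDegree E v = ∑ e ∈ E, (e ∩ J).card := by
  have := sum_hyperDegree_mul E J fun _ => 1
  simp only [mul_one, Finset.sum_const, nsmul_eq_mul] at this
  exact_mod_cast this

theorem card_filter_superset_completeHypergraph {k : ℕ} (T : Finset (Fin n)) (hT : T.card ≤ k) :
    ((completeHypergraph n k).filter (T ⊆ ·)).card = (n - T.card).choose (k - T.card) := by
  rw [completeHypergraph, Finset.card_filter_powersetCard_subset _ _ _ (Finset.subset_univ T) hT,
    Finset.card_univ, Fintype.card_fin]

theorem hyperDegree_completeHypergraph {k : ℕ} (hk : 1 ≤ k) (v : Fin n) :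
    hyperDegree (completeHypergraph n k) v = (n - 1).choose (k - 1) := by
  have := card_filter_superset_completeHypergraph (k := k) {v} (by simpa using hk)
  simpa [hyperDegree] using this

theorem card_filter_pair_completeHypergraph {k : ℕ} (hk : 2 ≤ k) {u v : Fin n} (h : u ≠ v) :
    ((completeHypergraph n k).filter (fun e => u ∈ e ∧ v ∈ e)).card = (n - 2).choose (k - 2) := by
  have := card_filter_superset_completeHypergraph (k := k) {u, v}
    (by rw [Finset.card_pair h]; exact hk)
  rw [Finset.card_pair h] at this
  rw [← this]
  congr 1
  ext e
  simp [Finset.insert_subset_iff]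

theorem card_of_mem_completeHypergraph {k : ℕ} {e : Finset (Fin n)}
    (he : e ∈ completeHypergraph n k) : e.card = k :=
  (Finset.mem_powersetCard.1 he).2

/-! ### Positions of the game -/

/-- The free elements `F` and Maker's elements `M` form a possible position of a game on the
board `E`. Breaker's elements are then those of `(E \ F) \ M`. -/
def IsPosition {α : Type} [DecidableEq α] (E F M : Finset α) : Prop :=
  F ⊆ E ∧ M ⊆ E ∧ Disjoint F M

theorem IsPosition.initial {α : Type} [DecidableEq α] (E : Finset α) : IsPosition E E ∅ :=
  ⟨subset_rfl, Finset.empty_subset _, Finset.disjoint_empty_right _⟩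

theorem IsPosition.round {α : Type} [DecidableEq α] {E F M S : Finset α} {e : α}
    (h : IsPosition E F M) (he : e ∈ F) :
    IsPosition E (F.erase e \ S) (insert e M) := by
  obtain ⟨hF, hM, hd⟩ := h
  refine ⟨Finset.sdiff_subset.trans ((Finset.erase_subset _ _).trans hF),
    Finset.insert_subset (hF he) hM, ?_⟩
  rw [Finset.disjoint_left] at hd ⊢
  intro a ha ha'
  simp only [Finset.mem_sdiff, Finset.mem_erase, Finset.mem_insert] at ha ha'
  tauto

theorem IsPosition.breaker_round {α : Type} [DecidableEq α] {E F M S : Finset α} {e : α}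
    (h : IsPosition E F M) (he : e ∈ F) (hS : S ⊆ F.erase e) :
    (E \ (F.erase e \ S)) \ insert e M = ((E \ F) \ M) ∪ S ∧ Disjoint ((E \ F) \ M) S := by
  obtain ⟨hF, hM, hd⟩ := h
  rw [Finset.disjoint_left] at hd
  constructor
  · ext a
    have h1 := @hF a
    have h2 := @hd a
    have h3 := @hS a
    simp only [Finset.mem_sdiff, Finset.mem_erase, Finset.mem_insert, Finset.mem_union] at *
    by_cases hae : a = e
    · subst hae; tauto
    · tauto
  · rw [Finset.disjoint_left]
    intro a ha ha'
    have h3 := hS ha'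
    simp only [Finset.mem_sdiff, Finset.mem_erase] at *
    tauto

theorem IsPosition.hyperDegree_add {E F M : Finset (Finset (Fin n))} (h : IsPosition E F M)
    (v : Fin n) : hyperDegree F v + hyperDegree M v + hyperDegree ((E \ F) \ M) v
      = hyperDegree E v := by
  rw [← hyperDegree_union h.2.2, ← hyperDegree_union]
  · congr 1
    ext a
    have h1 := @h.1 a
    have h2 := @h.2.1 a
    simp only [Finset.mem_sdiff, Finset.mem_union]
    tauto
  · rw [Finset.disjoint_left]
    intro a ha ha'
    simp only [Finset.mem_sdiff, Finset.mem_union] at *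
    tauto

end Degrees

/-! ### Maker's strategy for large bias: attending to the vertex in most danger -/

section Danger

variable {n : ℕ}

/-- The danger of the vertex `v` when Breaker owns `B` and Maker owns `M`; one edge of Maker
outweighs `κ` edges of Breaker. -/
def danger (κ : ℝ) (B M : Finset (Finset (Fin n))) (v : Fin n) : ℝ :=
  hyperDegree B v - κ * hyperDegree M v

/-- By how much the sum over `J` of the degrees in `B` exceeds the number of edges of `B` that
meet `J`; the subtraction is truncated, so edges that miss `J` contribute nothing. -/
def overlap (B : Finset (Finset (Fin n))) (J : Finset (Fin n)) : ℕ :=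
  ∑ f ∈ B, ((f ∩ J).card - 1)

theorem overlap_union {B S : Finset (Finset (Fin n))} (h : Disjoint B S) (J : Finset (Fin n)) :
    overlap (B ∪ S) J = overlap B J + overlap S J :=
  Finset.sum_union h

theorem overlap_singleton (B : Finset (Finset (Fin n))) (v : Fin n) : overlap B {v} = 0 := by
  refine Finset.sum_eq_zero fun f _ => ?_
  have : (f ∩ {v}).card ≤ 1 := (Finset.card_le_card Finset.inter_subset_right).trans (by simp)
  omega

theorem sum_hyperDegree_le_overlap (S : Finset (Finset (Fin n))) (J : Finset (Fin n)) :
    ∑ v ∈ J, hyperDegree S v ≤ S.card + overlap S J := by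
  rw [sum_hyperDegree, overlap, Finset.card_eq_sum_ones, ← Finset.sum_add_distrib]
  exact Finset.sum_le_sum fun f _ => by omega

theorem sum_hyperDegree_le_mul {k : ℕ} {S : Finset (Finset (Fin n))} (hS : ∀ f ∈ S, f.card ≤ k)
    (J : Finset (Fin n)) : ∑ v ∈ J, hyperDegree S v ≤ k * S.card := by
  rw [sum_hyperDegree, mul_comm, ← smul_eq_mul]
  exact Finset.sum_le_card_nsmul _ _ _ fun f hf =>
    (Finset.card_le_card Finset.inter_subset_left).trans (hS f hf)

/-- Adding a vertex `v` to `J` raises the overlap by at most the number of edges joining `v`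
to `J`. -/
theorem overlap_insert_le {c : ℕ} {B : Finset (Finset (Fin n))} {J : Finset (Fin n)} {v : Fin n}
    (hv : v ∉ J) (hc : ∀ u, u ≠ v → (B.filter (fun f => u ∈ f ∧ v ∈ f)).card ≤ c) :
    overlap B (insert v J) ≤ overlap B J + J.card * c := by
  have h1 : ∀ f ∈ B, (f ∩ insert v J).card - 1 ≤
      ((f ∩ J).card - 1) + ∑ u ∈ J, if u ∈ f ∧ v ∈ f then 1 else 0 := by
    intro f _
    by_cases hvf : v ∈ f
    · rw [Finset.inter_insert_of_mem hvf, Finset.card_insert_of_notMem (by simp [hv])]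
      have : ∑ u ∈ J, (if u ∈ f ∧ v ∈ f then 1 else 0) = (f ∩ J).card := by
        rw [← Finset.card_filter, Finset.inter_comm, ← Finset.filter_mem_eq_inter]
        simp [hvf]
      omega
    · rw [Finset.inter_insert_of_notMem hvf]
      omega
  calc overlap B (insert v J) ≤ overlap B J + ∑ f ∈ B, ∑ u ∈ J, if u ∈ f ∧ v ∈ f then 1 else 0 := by
        unfold overlap
        rw [← Finset.sum_add_distrib]
        exact Finset.sum_le_sum h1
    _ ≤ overlap B J + J.card * c := by
        rw [Finset.sum_comm, ← smul_eq_mul]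
        gcongr
        refine Finset.sum_le_card_nsmul _ _ _ fun u hu => ?_
        rw [← Finset.card_filter]
        exact hc u (by rintro rfl; exact hv hu)

/-- If `f` attains its maximum over `insert v J` at `v`, then the average of `f` over `J` is at
most the one over `insert v J`; here this is stated for upper bounds with an error term `X`. -/
theorem sum_le_of_sum_insert_le {J : Finset (Fin n)} {v : Fin n} {f : Fin n → ℝ} {G X : ℝ}
    (hv : v ∉ J) (hX : 0 ≤ X) (hmax : ∀ u ∈ J, f u ≤ f v)
    (h : ∑ u ∈ insert v J, f u ≤ (insert v J).card * G + X) :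
    ∑ u ∈ J, f u ≤ J.card * G + X := by
  rw [Finset.sum_insert hv, Finset.card_insert_of_notMem hv] at h
  have h1 : ∑ u ∈ J, f u ≤ J.card * f v := by
    rw [← nsmul_eq_mul]
    exact Finset.sum_le_card_nsmul _ _ _ hmax
  push_cast at h
  have hr : (0 : ℝ) ≤ J.card := Nat.cast_nonneg _
  by_contra! hlt
  have h2 : f v < G := by linarith
  have h3 := mul_le_mul_of_nonneg_left h2.le hr
  linarith

/-- The invariant of Maker's danger strategy. A vertex is active while Maker owns fewer than `m`
edges at it. The average danger over any `r` active vertices is at most `h r`, and for `r ≤ R` the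
total danger is at most `r * g r` plus the overlap, since for few vertices most of Breaker's edges
meet at most one of them. -/
structure DangerInvariant (k b m R : ℕ) (g h : ℕ → ℝ) (E F M : Finset (Finset (Fin n))) :
    Prop where
  position : IsPosition E F M
  average : ∀ J : Finset (Fin n), J.Nonempty → (∀ v ∈ J, hyperDegree M v < m) →
    ∑ v ∈ J, danger (k * b) ((E \ F) \ M) M v ≤ J.card * h J.card
  average_small : ∀ J : Finset (Fin n), J.Nonempty → (∀ v ∈ J, hyperDegree M v < m) →
    J.card ≤ R →
    ∑ v ∈ J, danger (k * b) ((E \ F) \ M) M v ≤ J.card * g J.card + overlap ((E \ F) \ M) J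

theorem DangerInvariant.hyperDegree_breaker_le {k b m R : ℕ} {g h : ℕ → ℝ}
    {E F M : Finset (Finset (Fin n))} (I : DangerInvariant k b m R g h E F M) (hR : 1 ≤ R)
    {v : Fin n} (hv : hyperDegree M v < m) :
    (hyperDegree ((E \ F) \ M) v : ℝ) ≤ g 1 + k * b * (m - 1) := by
  have := I.average_small {v} (by simp) (by simpa using hv) (by simpa using hR)
  rw [overlap_singleton] at this
  simp only [Finset.sum_singleton, Finset.card_singleton, Nat.cast_one, one_mul, danger,
    Nat.cast_zero, add_zero] at this
  have h1 : (hyperDegree M v : ℝ) ≤ m - 1 := by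
    have : (hyperDegree M v : ℝ) + 1 ≤ m := by exact_mod_cast hv
    linarith
  have h2 := mul_le_mul_of_nonneg_left h1 (by positivity : (0 : ℝ) ≤ k * b)
  linarith

theorem DangerInvariant.round {k b m R c : ℕ} {g h : ℕ → ℝ}
    {E F M : Finset (Finset (Fin n))} (I : DangerInvariant k b m R g h E F M)
    (hE : ∀ f ∈ E, f.card ≤ k)
    (hc : ∀ u v, u ≠ v → (E.filter (fun f => u ∈ f ∧ v ∈ f)).card ≤ c)
    (hh : ∀ r, 1 ≤ r → r < n → h (r + 1) + k * b / r ≤ h r)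
    (hg : ∀ r, 1 ≤ r → r < R → g (r + 1) + b / r + c ≤ g r) (hgh : h R ≤ g R)
    {v : Fin n} {e : Finset (Fin n)} (he : e ∈ F) (hve : v ∈ e)
    (hv : hyperDegree M v < m)
    (hmax : ∀ u, hyperDegree M u < m →
      danger (k * b) ((E \ F) \ M) M u ≤ danger (k * b) ((E \ F) \ M) M v)
    {S : Finset (Finset (Fin n))} (hS : S ⊆ F.erase e) (hSb : S.card ≤ b) :
    DangerInvariant k b m R g h E (F.erase e \ S) (insert e M) := by
  obtain ⟨hB, hdisj⟩ := I.position.breaker_round he hS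
  set B := (E \ F) \ M
  have heM : e ∉ M := Finset.disjoint_left.1 I.position.2.2 he
  have hBE : B ⊆ E := Finset.sdiff_subset.trans Finset.sdiff_subset
  have hSE : S ⊆ E := hS.trans ((Finset.erase_subset _ _).trans I.position.1)
  have hactive : ∀ u, hyperDegree (insert e M) u < m → hyperDegree M u < m := fun u hu =>
    (hyperDegree_mono (Finset.subset_insert _ _) u).trans_lt hu
  have hkb : (0 : ℝ) ≤ k * b := by positivity
  have hstep : ∀ u, danger (k * b) (B ∪ S) (insert e M) u =
      danger (k * b) B M u + hyperDegree S u - if u ∈ e then (k * b : ℝ) else 0 := by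
    intro u
    unfold danger
    rw [hyperDegree_union hdisj, hyperDegree_insert heM]
    split_ifs <;> push_cast <;> ring
  have hsum : ∀ J : Finset (Fin n), ∑ u ∈ J, danger (k * b) (B ∪ S) (insert e M) u ≤
      ∑ u ∈ J, danger (k * b) B M u + (∑ u ∈ J, hyperDegree S u : ℕ)
        - if v ∈ J then (k * b : ℝ) else 0 := by
    intro J
    rw [Finset.sum_congr rfl fun u _ => hstep u, Finset.sum_sub_distrib, Finset.sum_add_distrib,
      Nat.cast_sum]
    gcongr
    split_ifs with hvJ
    · calc (k * b : ℝ) = if v ∈ e then (k * b : ℝ) else 0 := by rw [if_pos hve]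
        _ ≤ _ := Finset.single_le_sum (f := fun u => if u ∈ e then (k * b : ℝ) else 0)
          (fun u _ => by split_ifs <;> simp [hkb]) hvJ
    · exact Finset.sum_nonneg fun u _ => by split_ifs <;> simp [hkb]
  have hS1 : ∀ J : Finset (Fin n), ((∑ u ∈ J, hyperDegree S u : ℕ) : ℝ) ≤ k * b := by
    intro J
    exact_mod_cast (sum_hyperDegree_le_mul (fun f hf => hE f (hSE hf)) J).trans
      (Nat.mul_le_mul_left k hSb)
  have hS2 : ∀ J : Finset (Fin n), ((∑ u ∈ J, hyperDegree S u : ℕ) : ℝ) ≤ b + overlap S J := by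
    intro J
    exact_mod_cast (sum_hyperDegree_le_overlap S J).trans (Nat.add_le_add_right hSb _)
  have haverage : ∀ J : Finset (Fin n), J.Nonempty → (∀ u ∈ J, hyperDegree (insert e M) u < m) →
      ∑ u ∈ J, danger (k * b) (B ∪ S) (insert e M) u ≤ J.card * h J.card := by
    intro J hJ hJm
    have hJm' : ∀ u ∈ J, hyperDegree M u < m := fun u hu => hactive u (hJm u hu)
    have h1 := hsum J
    have h2 := hS1 J
    by_cases hvJ : v ∈ J
    · rw [if_pos hvJ] at h1
      linarith [I.average J hJ hJm']
    · rw [if_neg hvJ] at h1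
      have hr : 1 ≤ J.card := hJ.card_pos
      have hrn : J.card < n := by
        have := Finset.card_le_univ (insert v J)
        rw [Finset.card_insert_of_notMem hvJ, Fintype.card_fin] at this
        omega
      have hins := I.average (insert v J) (Finset.insert_nonempty _ _)
        (fun u hu => (Finset.mem_insert.1 hu).elim (fun h => h ▸ hv) (hJm' u))
      have h3 := sum_le_of_sum_insert_le hvJ le_rfl (fun u hu => hmax u (hJm' u hu))
        (by rw [add_zero]; exact hins)
      rw [Finset.card_insert_of_notMem hvJ] at h3
      have hr0 : (0 : ℝ) < J.card := by exact_mod_cast hr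
      have h4 := mul_le_mul_of_nonneg_left (hh J.card hr hrn) hr0.le
      rw [mul_add, mul_div_cancel₀ _ hr0.ne'] at h4
      linarith
  refine ⟨I.position.round he, ?_, ?_⟩
  · rw [hB]
    exact haverage
  · rw [hB]
    intro J hJ hJm hJR
    have hJm' : ∀ u ∈ J, hyperDegree M u < m := fun u hu => hactive u (hJm u hu)
    have h1 := hsum J
    have hr : 1 ≤ J.card := hJ.card_pos
    have hr0 : (0 : ℝ) < J.card := by exact_mod_cast hr
    have hXS : (0 : ℝ) ≤ overlap S J := Nat.cast_nonneg _
    have hXU : (0 : ℝ) ≤ overlap (B ∪ S) J := Nat.cast_nonneg _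
    by_cases hvJ : v ∈ J
    · rw [if_pos hvJ] at h1
      rw [overlap_union hdisj]
      push_cast
      linarith [I.average_small J hJ hJm' hJR, hS1 J]
    · rw [if_neg hvJ] at h1
      obtain hlt | heq := hJR.lt_or_eq
      · have hins := I.average_small (insert v J) (Finset.insert_nonempty _ _)
          (fun u hu => (Finset.mem_insert.1 hu).elim (fun h => h ▸ hv) (hJm' u))
          (by rw [Finset.card_insert_of_notMem hvJ]; exact hlt)
        have h3 := sum_le_of_sum_insert_le hvJ (Nat.cast_nonneg _)
          (fun u hu => hmax u (hJm' u hu)) hins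
        rw [Finset.card_insert_of_notMem hvJ] at h3
        have h5 : (overlap B (insert v J) : ℝ) ≤ overlap B J + J.card * c := by
          exact_mod_cast overlap_insert_le hvJ fun u hu =>
            (Finset.card_le_card (Finset.filter_subset_filter _ hBE)).trans (hc u v hu)
        have h4 := mul_le_mul_of_nonneg_left (hg J.card hr hlt) hr0.le
        rw [mul_add, mul_add, mul_div_cancel₀ _ hr0.ne'] at h4
        rw [overlap_union hdisj]
        push_cast
        linarith [hS2 J]
      · have h3 := haverage J hJ hJm
        rw [heq] at h3 ⊢
        have h4 := mul_le_mul_of_nonneg_left hgh (Nat.cast_nonneg (α := ℝ) R)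
        linarith

theorem makerWins_of_danger {k b m R c D : ℕ} {g h : ℕ → ℝ} {E : Finset (Finset (Fin n))}
    (hE : ∀ f ∈ E, f.card ≤ k) (hD : ∀ v, D ≤ hyperDegree E v)
    (hc : ∀ u v, u ≠ v → (E.filter (fun f => u ∈ f ∧ v ∈ f)).card ≤ c) (hR : 1 ≤ R)
    (hh0 : ∀ r, 0 ≤ h r) (hh : ∀ r, 1 ≤ r → r < n → h (r + 1) + k * b / r ≤ h r)
    (hg0 : ∀ r, 0 ≤ g r) (hg : ∀ r, 1 ≤ r → r < R → g (r + 1) + b / r + c ≤ g r)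
    (hgh : h R ≤ g R) (hwin : g 1 + k * b * (m - 1) + m ≤ D) :
    MakerWinsFrom b (HasMinDegree (n := n) m) E ∅ := by
  have hfree : ∀ F M : Finset (Finset (Fin n)), DangerInvariant k b m R g h E F M →
      ∀ v, hyperDegree M v < m → 0 < hyperDegree F v := by
    intro F M I v hv
    have h1 := I.hyperDegree_breaker_le hR hv
    have h2 : (hyperDegree ((E \ F) \ M) v : ℝ) + m ≤ D := by linarith
    have h3 : hyperDegree ((E \ F) \ M) v + m ≤ D := by exact_mod_cast h2
    have h4 := I.position.hyperDegree_add v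
    have := hD v
    omega
  refine MakerWinsFrom.of_invariant (DangerInvariant k b m R g h E) ?_ ?_ ?_
  · intro M I v
    by_contra! hv
    have := hfree _ _ I v hv
    simp [hyperDegree] at this
  · intro F M hF I
    by_cases hA : ∃ v, hyperDegree M v < m
    · obtain ⟨v, hv, hmax⟩ := Finset.exists_max_image
        (Finset.univ.filter fun v => hyperDegree M v < m) (danger (k * b) ((E \ F) \ M) M)
        (by obtain ⟨v, hv⟩ := hA; exact ⟨v, by simpa using hv⟩)
      simp only [Finset.mem_filter, Finset.mem_univ, true_and] at hv hmax
      obtain ⟨e, he, hve⟩ := exists_mem_of_hyperDegree_pos (hfree F M I v hv)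
      exact ⟨e, he, fun S hS hSb => I.round hE hc hh hg hgh he hve hv hmax hS hSb⟩
    · -- With no active vertex left, Maker has won already and may claim any edge.
      push Not at hA
      obtain ⟨e, he⟩ := hF
      have hA' : ∀ v, m ≤ hyperDegree (insert e M) v := fun v =>
        (hA v).trans (hyperDegree_mono (Finset.subset_insert _ _) v)
      refine ⟨e, he, fun S hS hSb => ⟨I.position.round he, ?_, ?_⟩⟩
      · rintro J ⟨v, hv⟩ hJ
        exact absurd (hJ v hv) (hA' v).not_gt
      · rintro J ⟨v, hv⟩ hJ
        exact absurd (hJ v hv) (hA' v).not_gt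
  · have h0 : ∀ v, danger (k * b) ((E \ E) \ ∅) (∅ : Finset (Finset (Fin n))) v = 0 := by
      intro v
      simp [danger, hyperDegree]
    refine ⟨IsPosition.initial E, fun J _ _ => ?_, fun J _ _ _ => ?_⟩
    · rw [Finset.sum_eq_zero fun v _ => h0 v]
      exact mul_nonneg (Nat.cast_nonneg _) (hh0 _)
    · rw [Finset.sum_eq_zero fun v _ => h0 v]
      exact add_nonneg (mul_nonneg (Nat.cast_nonneg _) (hg0 _)) (Nat.cast_nonneg _)

end Danger

/-! ### Maker's strategy for small bias: an exponential potential -/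

section Potential

variable {n : ℕ}

/-- The weight of a vertex in Maker's potential function when Breaker owns `B` and Maker owns `M`:
`b` edges of Breaker multiply it by `1 + t`, one edge of Maker multiplies it by `1 - t`. -/
noncomputable def vertexWeight (b : ℕ) (t : ℝ) (B M : Finset (Finset (Fin n))) (v : Fin n) : ℝ :=
  (1 + t) ^ ((hyperDegree B v : ℝ) / b) * (1 - t) ^ hyperDegree M v

theorem vertexWeight_nonneg {b : ℕ} {t : ℝ} (ht0 : 0 ≤ t) (ht1 : t ≤ 1)
    (B M : Finset (Finset (Fin n))) (v : Fin n) : 0 ≤ vertexWeight b t B M v :=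
  mul_nonneg (Real.rpow_nonneg (by linarith) _) (pow_nonneg (by linarith) _)

/-- If Maker claims an edge `e` of maximal weight, then the total weight does not increase during
the round: each edge of Breaker costs at most `t / b` times the weight of `e`. -/
theorem sum_vertexWeight_round_le {b : ℕ} {t : ℝ} (hb : 1 ≤ b) (ht0 : 0 ≤ t) (ht1 : t ≤ 1)
    {B M S : Finset (Finset (Fin n))} {e : Finset (Fin n)} (hBS : Disjoint B S) (he : e ∉ M)
    (hS : S.card ≤ b)
    (hmax : ∀ f ∈ S, ∑ v ∈ f, vertexWeight b t B M v ≤ ∑ v ∈ e, vertexWeight b t B M v) :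
    ∑ v, vertexWeight b t (B ∪ S) (insert e M) v ≤ ∑ v, vertexWeight b t B M v := by
  have hb0 : (0 : ℝ) < b := by exact_mod_cast hb
  set w := vertexWeight b t B M with hw
  have hw0 : ∀ v, 0 ≤ w v := vertexWeight_nonneg ht0 ht1 B M
  have hstep : ∀ v, vertexWeight b t (B ∪ S) (insert e M) v ≤
      w v + t / b * (hyperDegree S v * w v) - t * if v ∈ e then w v else 0 := by
    intro v
    have hd : (hyperDegree S v : ℝ) / b ≤ 1 := by
      rw [div_le_one hb0]
      exact_mod_cast (Finset.card_filter_le _ _).trans hS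
    have hbern : (1 + t) ^ ((hyperDegree S v : ℝ) / b) ≤ 1 + (hyperDegree S v : ℝ) / b * t :=
      rpow_one_add_le_one_add_mul_self (by linarith) (by positivity) hd
    have heq : vertexWeight b t (B ∪ S) (insert e M) v =
        w v * ((1 + t) ^ ((hyperDegree S v : ℝ) / b) * (1 - t) ^ (if v ∈ e then 1 else 0)) := by
      rw [hw, vertexWeight, vertexWeight, hyperDegree_union hBS, hyperDegree_insert he,
        Nat.cast_add, add_div, Real.rpow_add (by linarith), pow_add]
      ring
    have hx : (0 : ℝ) ≤ (hyperDegree S v : ℝ) / b * t := by positivity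
    have hrhs : w v + t / b * (hyperDegree S v * w v) - t * (if v ∈ e then w v else 0) =
        w v * (1 + (hyperDegree S v : ℝ) / b * t - if v ∈ e then t else 0) := by
      split_ifs
      · field_simp
      · field_simp
        ring
    rw [heq, hrhs]
    refine mul_le_mul_of_nonneg_left ?_ (hw0 v)
    split_ifs
    · rw [pow_one]
      calc _ ≤ (1 + (hyperDegree S v : ℝ) / b * t) * (1 - t) :=
            mul_le_mul_of_nonneg_right hbern (by linarith)
        _ ≤ _ := by nlinarith [mul_nonneg hx ht0]
    · simpa using hbern
  have hsumS : ∑ v, (hyperDegree S v : ℝ) * w v ≤ b * ∑ v ∈ e, w v := by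
    rw [sum_hyperDegree_mul]
    simp only [Finset.inter_univ]
    calc ∑ f ∈ S, ∑ v ∈ f, w v ≤ S.card • ∑ v ∈ e, w v := Finset.sum_le_card_nsmul _ _ _ hmax
      _ = (S.card : ℝ) * ∑ v ∈ e, w v := nsmul_eq_mul _ _
      _ ≤ _ := by
        gcongr
        exact Finset.sum_nonneg fun v _ => hw0 v
  calc _ ≤ ∑ v, (w v + t / b * (hyperDegree S v * w v) - t * if v ∈ e then w v else 0) :=
        Finset.sum_le_sum fun v _ => hstep v
    _ = ∑ v, w v + t / b * ∑ v, (hyperDegree S v * w v) - t * ∑ v ∈ e, w v := by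
        rw [Finset.sum_sub_distrib, Finset.sum_add_distrib, ← Finset.mul_sum, ← Finset.mul_sum,
          ← Finset.sum_filter, Finset.filter_univ_mem]
    _ ≤ ∑ v, w v + t / b * (b * ∑ v ∈ e, w v) - t * ∑ v ∈ e, w v := by gcongr
    _ = ∑ v, w v := by field_simp; ring

theorem makerWins_of_potential {b m D : ℕ} {t : ℝ} {E : Finset (Finset (Fin n))}
    (hb : 1 ≤ b) (ht0 : 0 ≤ t) (ht1 : t ≤ 1) (hD : ∀ v, D ≤ hyperDegree E v)
    (hwin : (n : ℝ) < (1 + t) ^ (((D : ℝ) - m) / b) * (1 - t) ^ m) :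
    MakerWinsFrom b (HasMinDegree (n := n) m) E ∅ := by
  refine MakerWinsFrom.of_invariant
    (fun F M => IsPosition E F M ∧ ∑ v, vertexWeight b t ((E \ F) \ M) M v ≤ n) ?_ ?_ ?_
  · rintro M ⟨hpos, hsum⟩ v
    by_contra! hv
    have hdeg := hpos.hyperDegree_add v
    have hDv := hD v
    have hF : hyperDegree (∅ : Finset (Finset (Fin n))) v = 0 := by simp [hyperDegree]
    have hBv : D ≤ hyperDegree ((E \ ∅) \ M) v + m := by omega
    have hBv' : (D : ℝ) - m ≤ hyperDegree ((E \ ∅) \ M) v := by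
      have : (D : ℝ) ≤ hyperDegree ((E \ ∅) \ M) v + m := by exact_mod_cast hBv
      linarith
    have h1 : (1 + t) ^ (((D : ℝ) - m) / b) * (1 - t) ^ m ≤
        vertexWeight b t ((E \ ∅) \ M) M v := by
      unfold vertexWeight
      exact mul_le_mul
        (Real.rpow_le_rpow_of_exponent_le (by linarith) (by gcongr))
        (pow_le_pow_of_le_one (by linarith) (by linarith) hv.le)
        (pow_nonneg (by linarith) _) (Real.rpow_nonneg (by linarith) _)
    have h2 := Finset.single_le_sum (f := vertexWeight b t ((E \ ∅) \ M) M)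
      (fun v _ => vertexWeight_nonneg ht0 ht1 _ _ v) (Finset.mem_univ v)
    linarith
  · rintro F M hF ⟨hpos, hsum⟩
    obtain ⟨e, he, hmax⟩ := Finset.exists_max_image F
      (fun f => ∑ v ∈ f, vertexWeight b t ((E \ F) \ M) M v) hF
    refine ⟨e, he, fun S hS hSb => ⟨hpos.round he, ?_⟩⟩
    obtain ⟨hB, hdisj⟩ := hpos.breaker_round he hS
    rw [hB]
    exact (sum_vertexWeight_round_le hb ht0 ht1 hdisj (Finset.disjoint_left.1 hpos.2.2 he) hSb
      fun f hf => hmax f (Finset.mem_of_mem_erase (hS hf))).trans hsum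
  · refine ⟨IsPosition.initial E, ?_⟩
    simp [vertexWeight, hyperDegree]

end Potential

/-! ### Breaker's strategy: a box game on vertices that Maker has not touched -/

section Breaker

variable {n : ℕ}

/-- A position from which Breaker isolates a vertex by playing a box game. Maker has touched no
vertex of `U`, no free edge contains two vertices of `U`, and each vertex of `U` lies in at most
`∑ b / j` (integer division, `1 ≤ j < #U`) free edges: Maker can spoil only one box per round, and
Breaker claims `b / j` edges at each vertex when `j` of them are left. -/
def BoxPosition (b : ℕ) (F M : Finset (Finset (Fin n))) : Prop :=
  ∃ U : Finset (Fin n), U.Nonempty ∧ (∀ e ∈ M, Disjoint e U) ∧ (∀ e ∈ F, (e ∩ U).card ≤ 1) ∧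
    ∀ v ∈ U, hyperDegree F v ≤ ∑ j ∈ Finset.range (U.card - 1), b / (j + 1)

theorem not_hasMinDegree_of_disjoint {m : ℕ} (hm : 1 ≤ m) {M : Finset (Finset (Fin n))}
    {U : Finset (Fin n)} (hU : U.Nonempty) (hM : ∀ e ∈ M, Disjoint e U) :
    ¬ HasMinDegree m M := by
  obtain ⟨v, hv⟩ := hU
  intro h
  obtain ⟨e, he, hve⟩ := exists_mem_of_hyperDegree_pos (hm.trans (h v))
  exact Finset.disjoint_left.1 (hM e he) hve hv

theorem BoxPosition.round {b : ℕ} {F M : Finset (Finset (Fin n))} (h : BoxPosition b F M)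
    {e : Finset (Fin n)} (he : e ∈ F) :
    ∃ S : Finset (Finset (Fin n)), S ⊆ F.erase e ∧ S.card ≤ b ∧
      ∀ T, S ⊆ T → T ⊆ F.erase e → BoxPosition b (F.erase e \ T) (insert e M) := by
  obtain ⟨U, hU, hM, hF, hdeg⟩ := h
  have hsub : ∀ T, F.erase e \ T ⊆ F := fun T => Finset.sdiff_subset.trans (Finset.erase_subset _ _)
  obtain hU1 | ⟨r, hr⟩ : U.card = 1 ∨ ∃ r, U.card = r + 2 := by
    have := hU.card_pos
    by_cases h : U.card = 1
    · exact Or.inl h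
    · exact Or.inr ⟨U.card - 2, by omega⟩
  · -- The only vertex of `U` has no free edges, so Maker cannot touch it any more.
    refine ⟨∅, Finset.empty_subset _, by simp, fun T _ _ => ⟨U, hU, ?_, fun f hf => hF f (hsub T hf),
      fun v hv => (hyperDegree_mono (hsub T) v).trans (hdeg v hv)⟩⟩
    intro f hf
    obtain rfl | hf := Finset.mem_insert.1 hf
    · rw [Finset.disjoint_left]
      intro v hvf hvU
      have h0 := hdeg v hvU
      rw [hU1] at h0
      have : 0 < hyperDegree F v := Finset.card_pos.2 ⟨f, Finset.mem_filter.2 ⟨he, hvf⟩⟩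
      simp at h0
      omega
    · exact hM f hf
  · have hUe : r + 1 ≤ (U \ e).card := by
      have h1 := Finset.card_sdiff_add_card_inter U e
      have h2 := hF e he
      rw [Finset.inter_comm] at h2
      omega
    obtain ⟨U', hU'e, hU'⟩ := Finset.exists_subset_card_eq hUe
    have hU'U : U' ⊆ U := hU'e.trans Finset.sdiff_subset
    have hchoose : ∀ v, ∃ S ⊆ (F.erase e).filter (v ∈ ·),
        S.card = min (b / (r + 1)) (hyperDegree (F.erase e) v) := fun v =>
      Finset.exists_subset_card_eq (min_le_right _ _)
    choose S hS hScard using hchoose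
    refine ⟨U'.biUnion S, ?_, ?_, ?_⟩
    · exact Finset.biUnion_subset.2 fun v _ => (hS v).trans (Finset.filter_subset _ _)
    · calc (U'.biUnion S).card ≤ U'.card * (b / (r + 1)) :=
            Finset.card_biUnion_le_card_mul _ _ _ fun v _ => (hScard v).trans_le (min_le_left _ _)
        _ ≤ b := by rw [hU']; exact Nat.mul_div_le _ _
    · intro T hST _
      refine ⟨U', Finset.card_pos.1 (by omega), ?_, ?_, ?_⟩
      · intro f hf
        obtain rfl | hf := Finset.mem_insert.1 hf
        · exact (Finset.disjoint_of_subset_left hU'e Finset.sdiff_disjoint).symm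
        · exact Finset.disjoint_of_subset_right hU'U (hM f hf)
      · intro f hf
        exact (Finset.card_le_card (Finset.inter_subset_inter_left hU'U)).trans (hF f (hsub T hf))
      · intro v hv
        have h1 : hyperDegree (F.erase e \ T) v ≤
            hyperDegree (F.erase e) v - min (b / (r + 1)) (hyperDegree (F.erase e) v) := by
          rw [← hScard v, hyperDegree, hyperDegree, ← Finset.card_sdiff_of_subset (hS v)]
          refine Finset.card_le_card fun f hf => ?_
          simp only [Finset.mem_filter, Finset.mem_sdiff] at hf ⊢
          exact ⟨⟨hf.1.1, hf.2⟩, fun hfS =>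
            hf.1.2 (hST (Finset.mem_biUnion.2 ⟨v, hv, hfS⟩))⟩
        have h2 := hyperDegree_mono (Finset.erase_subset e F) v
        have h3 := hdeg v (hU'U hv)
        rw [hr, show r + 2 - 1 = r + 1 by omega, Finset.sum_range_succ] at h3
        rw [hU', Nat.add_sub_cancel]
        omega

/-- Breaker first needs `T` rounds to claim all edges with two vertices in a set `U`. Maker
touches at most `k * T` vertices of `U` in the meantime, and the remaining `s` vertices are enough
for the box game. -/
theorem breakerWins_of_boxes {k b m s T D : ℕ} (hm : 1 ≤ m) (hs : 1 ≤ s)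
    {E : Finset (Finset (Fin n))} (hE : ∀ f ∈ E, f.card ≤ k) (hD : ∀ v, hyperDegree E v ≤ D)
    (hbox : D ≤ ∑ j ∈ Finset.range (s - 1), b / (j + 1)) {U : Finset (Fin n)}
    (hU : k * T + s ≤ U.card) (hpairs : (E.filter fun f => 2 ≤ (f ∩ U).card).card ≤ b * T) :
    BreakerWinsFrom b (HasMinDegree (n := n) m) E ∅ := by
  let I₁ : Finset (Finset (Fin n)) → Finset (Finset (Fin n)) → Prop := fun F M =>
    F ⊆ E ∧ ∃ (T : ℕ) (U : Finset (Fin n)), (∀ e ∈ M, Disjoint e U) ∧ k * T + s ≤ U.card ∧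
      (F.filter fun f => 2 ≤ (f ∩ U).card).card ≤ b * T
  refine BreakerWinsFrom.of_invariant (fun F M => I₁ F M ∨ BoxPosition b F M) ?_ ?_
    (Or.inl ⟨subset_rfl, T, U, by simp, hU, hpairs⟩)
  · rintro M (⟨-, T, U, hM, hU, -⟩ | ⟨U, hU, hM, -⟩)
    · exact not_hasMinDegree_of_disjoint hm (Finset.card_pos.1 (by omega)) hM
    · exact not_hasMinDegree_of_disjoint hm hU hM
  · intro F M h e he
    by_cases hbp : BoxPosition b F M
    · obtain ⟨S, h1, h2, h3⟩ := hbp.round he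
      exact ⟨S, h1, h2, fun T h4 h5 => Or.inr (h3 T h4 h5)⟩
    obtain ⟨hFE, T, U, hM, hU, hpairs⟩ := h.resolve_right hbp
    obtain _ | T := T
    · refine absurd ⟨U, Finset.card_pos.1 (by omega), hM, fun f hf => ?_, fun v _ => ?_⟩ hbp
      · by_contra! hf2
        rw [mul_zero, Nat.le_zero, Finset.card_eq_zero] at hpairs
        exact Finset.notMem_empty f (hpairs ▸ Finset.mem_filter.2 ⟨hf, hf2⟩)
      · refine ((hyperDegree_mono hFE v).trans (hD v)).trans (hbox.trans ?_)
        exact Finset.sum_le_sum_of_subset (Finset.range_subset_range.2 (by omega))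
    · set P := (F.erase e).filter fun f => 2 ≤ (f ∩ (U \ e)).card with hP
      obtain ⟨S, hSP, hScard⟩ := Finset.exists_subset_card_eq (min_le_right b P.card)
      have hPcard : P.card ≤ b * T + b := by
        refine (Finset.card_le_card fun f hf => ?_).trans hpairs
        rw [hP, Finset.mem_filter] at hf
        exact Finset.mem_filter.2 ⟨Finset.mem_of_mem_erase hf.1, hf.2.trans
          (Finset.card_le_card (Finset.inter_subset_inter_left Finset.sdiff_subset))⟩
      refine ⟨S, hSP.trans (Finset.filter_subset _ _), hScard.trans_le (min_le_left _ _),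
        fun S' hS' hS'F => Or.inl ⟨?_, T, U \ e, ?_, ?_, ?_⟩⟩
      · exact Finset.sdiff_subset.trans ((Finset.erase_subset _ _).trans hFE)
      · intro f hf
        obtain rfl | hf := Finset.mem_insert.1 hf
        · exact Finset.disjoint_sdiff
        · exact Finset.disjoint_of_subset_right Finset.sdiff_subset (hM f hf)
      · have h1 := Finset.le_card_sdiff e U
        have h2 := hE e (hFE he)
        rw [mul_add, mul_one] at hU
        omega
      · have h1 : ((F.erase e \ S').filter fun f => 2 ≤ (f ∩ (U \ e)).card).card ≤
            P.card - S.card := by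
          rw [← Finset.card_sdiff_of_subset hSP]
          refine Finset.card_le_card fun f hf => ?_
          simp only [hP, Finset.mem_filter, Finset.mem_sdiff] at hf ⊢
          exact ⟨⟨hf.1.1, hf.2⟩, fun hfS => hf.1.2 (hS' hfS)⟩
        omega

/-- A set of `a` vertices contains two vertices of at most `a ^ 2 * c` edges when `c` bounds the
codegrees. -/
theorem card_filter_two_le_inter_le {c : ℕ} {E : Finset (Finset (Fin n))}
    (hc : ∀ u v, u ≠ v → (E.filter (fun f => u ∈ f ∧ v ∈ f)).card ≤ c) (U : Finset (Fin n)) :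
    (E.filter fun f => 2 ≤ (f ∩ U).card).card ≤ U.card ^ 2 * c := by
  have h1 : (E.filter fun f => 2 ≤ (f ∩ U).card) ⊆
      U.offDiag.biUnion fun p => E.filter fun f => p.1 ∈ f ∧ p.2 ∈ f := by
    intro f hf
    rw [Finset.mem_filter] at hf
    obtain ⟨u, hu, v, hv, huv⟩ := Finset.one_lt_card.1 (show 1 < (f ∩ U).card from hf.2)
    rw [Finset.mem_inter] at hu hv
    rw [Finset.mem_biUnion]
    exact ⟨(u, v), Finset.mem_offDiag.2 ⟨hu.2, hv.2, huv⟩,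
      Finset.mem_filter.2 ⟨hf.1, hu.1, hv.1⟩⟩
  refine (Finset.card_le_card h1).trans ((Finset.card_biUnion_le_card_mul _ _ c fun p hp =>
    hc _ _ (Finset.mem_offDiag.1 hp).2.2).trans (Nat.mul_le_mul_right c ?_))
  rw [Finset.offDiag_card, sq]
  exact Nat.sub_le _ _

end Breaker

/-! ### Estimates for degrees and codegrees -/

theorem le_choose_of_pos_of_lt {n j : ℕ} (hj : 1 ≤ j) (hjn : j < n) : n ≤ n.choose j := by
  induction n with
  | zero => omega
  | succ n ih =>
    obtain ⟨i, rfl⟩ : ∃ i, j = i + 1 := ⟨j - 1, by omega⟩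
    obtain h | h := (Nat.lt_succ_iff.1 hjn).lt_or_eq
    · have h1 := ih h
      have h2 : 0 < n.choose i := Nat.choose_pos (by omega)
      rw [Nat.choose_succ_succ']
      omega
    · rw [h, Nat.choose_succ_self_right]

theorem cast_le_choose_pred {n k : ℕ} (hk : 2 ≤ k) (hn : k ≤ n) :
    (n : ℝ) ≤ n.choose (k - 1) := by
  exact_mod_cast le_choose_of_pos_of_lt (by omega) (by omega)

theorem degree_lower_bound {n k : ℕ} (hk : 2 ≤ k) (hn : k ≤ n) {δ : ℝ} (h : (k : ℝ) ≤ δ * n) :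
    (1 - δ) * (n.choose (k - 1) : ℝ) ≤ (n - 1).choose (k - 1) := by
  obtain ⟨i, rfl⟩ : ∃ i, n = i + 1 := ⟨n - 1, by omega⟩
  have h1 := Nat.choose_mul_succ_eq i (k - 1)
  have h2 : (i.choose (k - 1) : ℝ) * ((i + 1 : ℕ) : ℝ) =
      (i + 1).choose (k - 1) * (((i + 1 : ℕ) : ℝ) - (k - 1 : ℕ)) := by
    rw [← Nat.cast_sub (by omega)]
    exact_mod_cast h1
  have hn0 : (0 : ℝ) < ((i + 1 : ℕ) : ℝ) := by positivity
  have h3 : ((k - 1 : ℕ) : ℝ) ≤ k := by exact_mod_cast Nat.sub_le _ _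
  rw [Nat.add_sub_cancel]
  refine le_of_mul_le_mul_right ?_ hn0
  rw [h2]
  have := mul_le_mul_of_nonneg_left (h3.trans h)
    (Nat.cast_nonneg (α := ℝ) ((i + 1).choose (k - 1)))
  linarith

theorem codegree_upper_bound {n k : ℕ} (hk : 2 ≤ k) (hn : k ≤ n) :
    ((n - 2).choose (k - 2) : ℝ) * n ≤ 2 * k * n.choose (k - 1) := by
  obtain ⟨i, rfl⟩ : ∃ i, n = i + 2 := ⟨n - 2, by omega⟩
  obtain ⟨l, rfl⟩ : ∃ l, k = l + 2 := ⟨k - 2, by omega⟩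
  have h1 := Nat.add_one_mul_choose_eq i l
  have h2 : (i + 1).choose (l + 1) ≤ (i + 2).choose (l + 1) := Nat.choose_le_choose _ (by omega)
  have h3 : i.choose l * (i + 2) ≤ 2 * (l + 2) * (i + 2).choose (l + 1) := by
    calc i.choose l * (i + 2) ≤ 2 * ((i + 1) * i.choose l) := by nlinarith
      _ = 2 * ((i + 1).choose (l + 1) * (l + 1)) := by rw [h1]
      _ ≤ 2 * ((i + 2).choose (l + 1) * (l + 2)) := by gcongr; omega
      _ = _ := by ring
  have h4 : i + 2 - 2 = i := by omega
  have h5 : l + 2 - 2 = l := by omega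
  have h6 : l + 2 - 1 = l + 1 := by omega
  rw [h4, h5, h6]
  exact_mod_cast h3

/-! ### Maker's win -/

theorem makerWinsMinDegree_of_small_bias {n k b m : ℕ} (hk : 2 ≤ k) (hn : k ≤ n) (hb : 1 ≤ b)
    {δ : ℝ} (hδ0 : 0 < δ) (hδ1 : δ ≤ 1) (hkn : (k : ℝ) ≤ δ / 2 * n)
    (hm : (b : ℝ) * (k * m) ≤ (1 - δ) * n.choose (k - 1))
    (hlog : (b : ℝ) * Real.log n ≤ δ ^ 2 / 64 * n.choose (k - 1)) :
    MakerWinsMinDegree n k b m := by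
  have hD := degree_lower_bound hk hn hkn
  have hDN : ((n - 1).choose (k - 1) : ℝ) ≤ n.choose (k - 1) := by
    exact_mod_cast Nat.choose_le_choose _ (Nat.sub_le _ _)
  have hN := cast_le_choose_pred hk hn
  refine makerWins_of_potential (t := δ / 8) (D := (n - 1).choose (k - 1)) hb (by linarith)
    (by linarith) (fun v => (hyperDegree_completeHypergraph (by omega) v).ge) ?_
  set N : ℝ := ((n.choose (k - 1) : ℕ) : ℝ)
  set D : ℝ := (((n - 1).choose (k - 1) : ℕ) : ℝ)
  set t : ℝ := δ / 8 with ht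
  have hn0 : (0 : ℝ) < n := by exact_mod_cast (by omega : 0 < n)
  have hN0 : 0 < N := hn0.trans_le hN
  have hb1 : (1 : ℝ) ≤ b := by exact_mod_cast hb
  have hk2 : (2 : ℝ) ≤ k := by exact_mod_cast hk
  have hm0 : (0 : ℝ) ≤ m := Nat.cast_nonneg _
  have hbm : (0 : ℝ) ≤ b * m := by positivity
  have h2bm : 2 * (b * m : ℝ) ≤ (1 - δ) * N := by
    nlinarith [mul_le_mul_of_nonneg_right hk2 hbm]
  have hmbm : (m : ℝ) ≤ b * m := le_mul_of_one_le_left hm0 hb1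
  have ht0 : 0 < t := by positivity
  have ht1 : t ≤ 1 / 8 := by rw [ht]; linarith
  have hδN : 0 < δ * N := by positivity
  have hmD : (m : ℝ) ≤ D := by linarith
  have hlog1 : t - t ^ 2 ≤ Real.log (1 + t) := by
    refine le_trans ?_ (Real.one_sub_inv_le_log_of_pos (by linarith))
    have h1 : 1 - (1 + t)⁻¹ = t / (1 + t) := by field_simp; ring
    rw [h1, le_div_iff₀ (by linarith)]
    nlinarith [pow_pos ht0 3]
  have hlog2 : -(t + 2 * t ^ 2) ≤ Real.log (1 - t) := by
    refine le_trans ?_ (Real.one_sub_inv_le_log_of_pos (by linarith))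
    have h0 : 1 - t ≠ 0 := by linarith
    have h1 : 1 - (1 - t)⁻¹ = -(t / (1 - t)) := by field_simp; ring
    rw [h1, neg_le_neg_iff, div_le_iff₀ (by linarith)]
    nlinarith [mul_nonneg (sq_nonneg t) (by linarith : (0 : ℝ) ≤ 1 - 2 * t)]
  rw [← Real.log_lt_log_iff hn0 (mul_pos (Real.rpow_pos_of_pos (by linarith) _)
      (pow_pos (by linarith) _)), Real.log_mul (Real.rpow_pos_of_pos (by linarith) _).ne'
      (pow_pos (by linarith) _).ne', Real.log_rpow (by linarith), Real.log_pow]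
  have e1 : (D - m) / b * (t - t ^ 2) ≤ (D - m) / b * Real.log (1 + t) :=
    mul_le_mul_of_nonneg_left hlog1 (div_nonneg (by linarith) (by linarith))
  have e2 : (m : ℝ) * -(t + 2 * t ^ 2) ≤ m * Real.log (1 - t) :=
    mul_le_mul_of_nonneg_left hlog2 hm0
  refine lt_of_lt_of_le ?_ (add_le_add e1 e2)
  have hb0 : (0 : ℝ) < b := by linarith
  have e3 : (D - m) / b * (t - t ^ 2) + m * -(t + 2 * t ^ 2) =
      (t * (D - m - b * m) - t ^ 2 * (D - m + 2 * (b * m))) / b := by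
    field_simp
    ring
  rw [e3, lt_div_iff₀ hb0]
  have e4 : t * (δ / 2 * N) ≤ t * (D - m - b * m) :=
    mul_le_mul_of_nonneg_left (by linarith) ht0.le
  have e5 : t ^ 2 * (D - m + 2 * (b * m)) ≤ t ^ 2 * (2 * N) :=
    mul_le_mul_of_nonneg_left (by linarith) (sq_nonneg t)
  have e6 : t * (δ / 2 * N) - t ^ 2 * (2 * N) = δ ^ 2 / 32 * N := by rw [ht]; ring
  have e7 : 0 < δ ^ 2 * N := by positivity
  linarith

theorem sum_Ico_one_inv_le {R n : ℕ} (hR : 1 ≤ R) (hRn : R ≤ n) :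
    ∑ i ∈ Finset.Ico 1 R, (1 : ℝ) / i ≤ 1 + Real.log n := by
  have h1 := harmonic_le_one_add_log (R - 1)
  rw [harmonic_eq_sum_Icc] at h1
  have h2 : Finset.Icc 1 (R - 1) = Finset.Ico 1 R := by
    ext i
    simp only [Finset.mem_Icc, Finset.mem_Ico]
    omega
  rw [h2] at h1
  push_cast at h1
  simp only [one_div]
  refine h1.trans (add_le_add le_rfl ?_)
  obtain h | h := (R - 1).eq_zero_or_pos
  · rw [h, Nat.cast_zero, Real.log_zero]
    exact Real.log_natCast_nonneg _
  · exact Real.log_le_log (by exact_mod_cast h) (by exact_mod_cast (by omega : R - 1 ≤ n))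

/-- Most of the harmonic sum in the danger bound comes from `r ≤ η n`, where an edge of Breaker
counts only once; larger `r` contribute `O(b)`, and the overlap contributes `O(η N)`. -/
theorem makerWinsMinDegree_of_large_bias {n k b m : ℕ} (hk : 2 ≤ k) (hn : k ≤ n)
    {δ η : ℝ} (hη0 : 0 < η) (hη1 : η ≤ 1) (hηδ : 2 * k * η ≤ δ / 8) (hkn : (k : ℝ) ≤ δ / 2 * n)
    (hb : (b : ℝ) * (k * m + Real.log n) ≤ (1 - δ) * n.choose (k - 1))
    (hbN : (b : ℝ) * (1 + k / η) ≤ δ / 8 * n.choose (k - 1))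
    (hmN : (m : ℝ) ≤ δ / 8 * n.choose (k - 1)) :
    MakerWinsMinDegree n k b m := by
  have hD := degree_lower_bound hk hn hkn
  have hN := cast_le_choose_pred hk hn
  have hc := codegree_upper_bound hk hn
  have hn0 : (0 : ℝ) < n := by exact_mod_cast (by omega : 0 < n)
  set N : ℝ := ((n.choose (k - 1) : ℕ) : ℝ)
  set c : ℕ := (n - 2).choose (k - 2)
  set R : ℕ := ⌈η * n⌉₊
  have hR1 : 1 ≤ R := Nat.one_le_ceil_iff.2 (by positivity)
  have hRn : R ≤ n := Nat.ceil_le.2 (mul_le_of_le_one_left hn0.le hη1)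
  have hRη : η * n ≤ R := Nat.le_ceil _
  have hRη' : (R : ℝ) < η * n + 1 := Nat.ceil_lt_add_one (by positivity)
  have hR0 : (0 : ℝ) < R := by exact_mod_cast hR1
  have hN0 : 0 < N := hn0.trans_le hN
  let h : ℕ → ℝ := fun r => ∑ i ∈ Finset.Ico r n, (k * b : ℝ) / i
  let g : ℕ → ℝ := fun r => h R + ∑ i ∈ Finset.Ico r R, ((b : ℝ) / i + c)
  have hh0 : ∀ r, 0 ≤ h r := fun r => Finset.sum_nonneg fun i _ => by positivity
  refine makerWins_of_danger (k := k) (R := R) (c := c) (D := (n - 1).choose (k - 1)) (g := g)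
    (h := h) (fun f hf => (card_of_mem_completeHypergraph hf).le)
    (fun v => (hyperDegree_completeHypergraph (by omega) v).ge)
    (fun u v huv => (card_filter_pair_completeHypergraph hk huv).le) hR1 hh0 ?_ ?_ ?_ ?_ ?_
  · intro r _ hr
    simp only [h]
    rw [Finset.sum_eq_sum_Ico_succ_bot hr]
    linarith
  · exact fun r => add_nonneg (hh0 R) (Finset.sum_nonneg fun i _ => by positivity)
  · intro r _ hr
    simp only [g]
    rw [Finset.sum_eq_sum_Ico_succ_bot hr]
    linarith
  · simp [g]
  · have h1 : h R ≤ b * (k / η) := by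
      calc h R ≤ (Finset.Ico R n).card • ((k * b : ℝ) / R) := by
            refine Finset.sum_le_card_nsmul _ _ _ fun i hi => ?_
            have : (R : ℝ) ≤ i := by exact_mod_cast (Finset.mem_Ico.1 hi).1
            gcongr
        _ ≤ n * ((k * b : ℝ) / (η * n)) := by
            rw [nsmul_eq_mul, Nat.card_Ico]
            have : ((n - R : ℕ) : ℝ) ≤ n := by exact_mod_cast Nat.sub_le _ _
            gcongr
        _ = b * (k / η) := by field_simp
    have h2 : ∑ i ∈ Finset.Ico 1 R, ((b : ℝ) / i + c) ≤ b * (1 + Real.log n) + δ / 8 * N := by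
      rw [Finset.sum_add_distrib]
      refine add_le_add ?_ ?_
      · calc ∑ i ∈ Finset.Ico 1 R, (b : ℝ) / i = b * ∑ i ∈ Finset.Ico 1 R, (1 : ℝ) / i := by
              rw [Finset.mul_sum]
              exact Finset.sum_congr rfl fun i _ => by ring
          _ ≤ _ := mul_le_mul_of_nonneg_left (sum_Ico_one_inv_le hR1 hRn) (Nat.cast_nonneg _)
      · rw [Finset.sum_const, nsmul_eq_mul, Nat.card_Ico, Nat.cast_sub hR1, Nat.cast_one]
        calc ((R : ℝ) - 1) * c ≤ η * n * c :=
              mul_le_mul_of_nonneg_right (by linarith) (Nat.cast_nonneg _)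
          _ = η * (c * n) := by ring
          _ ≤ η * (2 * k * N) := mul_le_mul_of_nonneg_left hc hη0.le
          _ = 2 * k * η * N := by ring
          _ ≤ _ := mul_le_mul_of_nonneg_right hηδ hN0.le
    have h3 : g 1 = h R + ∑ i ∈ Finset.Ico 1 R, ((b : ℝ) / i + c) := rfl
    have h4 : (0 : ℝ) ≤ k * b := by positivity
    have h5 : 0 ≤ δ * N := by
      have : (0 : ℝ) ≤ 2 * k * η * N := by positivity
      linarith [mul_le_mul_of_nonneg_right hηδ hN0.le]
    rw [h3]
    linarith

theorem eventually_const_le_mul_natCast (C : ℝ) {δ : ℝ} (hδ : 0 < δ) :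
    ∀ᶠ n : ℕ in atTop, C ≤ δ * n :=
  (tendsto_natCast_atTop_atTop.const_mul_atTop hδ).eventually_ge_atTop C

theorem eventually_const_le_mul_log (C : ℝ) {δ : ℝ} (hδ : 0 < δ) :
    ∀ᶠ n : ℕ in atTop, C ≤ δ * Real.log n :=
  ((Real.tendsto_log_atTop.comp tendsto_natCast_atTop_atTop).const_mul_atTop hδ).eventually_ge_atTop
    C

theorem eventually_log_le_mul_rpow {δ ρ : ℝ} (hδ : 0 < δ) (hρ : 0 < ρ) :
    ∀ᶠ n : ℕ in atTop, Real.log n ≤ δ * (n : ℝ) ^ ρ := by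
  have h := ((isLittleO_log_rpow_atTop hρ).comp_tendsto tendsto_natCast_atTop_atTop).bound hδ
  filter_upwards [h] with n hn
  simp only [Function.comp_apply, Real.norm_eq_abs] at hn
  rw [abs_of_nonneg (Real.rpow_nonneg (Nat.cast_nonneg n) ρ)] at hn
  exact (le_abs_self _).trans hn

/-- Maker wins uniformly in the target degree `m` and the bias `b`, by the potential strategy if
`b` is below a small multiple of `N / log n` and by the danger strategy otherwise, when
`m = O(log n)`. -/
theorem eventually_makerWinsMinDegree {k : ℕ} (hk : 2 ≤ k) {δ : ℝ} (hδ0 : 0 < δ) (hδ1 : δ ≤ 1) :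
    ∀ᶠ n : ℕ in atTop, ∀ m b : ℕ, 1 ≤ b →
      (b : ℝ) * (k * m + Real.log n) ≤ (1 - δ) * n.choose (k - 1) →
        MakerWinsMinDegree n k b m := by
  have hk2 : (2 : ℝ) ≤ k := by exact_mod_cast hk
  set η : ℝ := δ / (16 * k) with hη
  have hη0 : 0 < η := by positivity
  have hη1 : η ≤ 1 := by
    rw [hη, div_le_one (by positivity)]
    linarith
  have hηδ : 2 * k * η ≤ δ / 8 := by
    rw [hη]
    apply le_of_eq
    field_simp
    norm_num
  filter_upwards [eventually_ge_atTop k, eventually_const_le_mul_natCast k (half_pos hδ0),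
    eventually_const_le_mul_log (1 + k / η) (by positivity : 0 < δ / 8),
    eventually_log_le_mul_rpow (by positivity : 0 < δ / 8 * (δ ^ 2 / 64)) one_pos]
    with n hn hkn hlogη hlogn m b hb hbound
  rw [Real.rpow_one] at hlogn
  have hN := cast_le_choose_pred hk hn
  have hn0 : (0 : ℝ) < n := by exact_mod_cast (by omega : 0 < n)
  set N : ℝ := ((n.choose (k - 1) : ℕ) : ℝ)
  have hN0 : 0 < N := hn0.trans_le hN
  have hlog0 : 0 < Real.log n := by
    have : 0 < 1 + k / η := by positivity
    exact pos_of_mul_pos_right (this.trans_le hlogη) (by positivity)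
  have hb0 : (0 : ℝ) < b := by exact_mod_cast hb
  have hm0 : (0 : ℝ) ≤ m := Nat.cast_nonneg _
  have hblog : 0 < b * Real.log n := by positivity
  have hbkm : (0 : ℝ) ≤ b * (k * m) := by positivity
  have hδN : 0 < δ * N := by positivity
  rw [mul_add] at hbound
  by_cases hsmall : (b : ℝ) * Real.log n ≤ δ ^ 2 / 64 * N
  · exact makerWinsMinDegree_of_small_bias hk hn hb hδ0 hδ1 hkn (by linarith) hsmall
  · push Not at hsmall
    refine makerWinsMinDegree_of_large_bias hk hn hη0 hη1 hηδ hkn (by rw [mul_add]; exact hbound)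
      ?_ ?_
    · calc (b : ℝ) * (1 + k / η) ≤ b * (δ / 8 * Real.log n) := by gcongr
        _ = δ / 8 * (b * Real.log n) := by ring
        _ ≤ δ / 8 * N := by gcongr; linarith
    · -- As `b` is large, the bound on `b * m` forces `m = O(log n)`.
      have h1 : (b : ℝ) * m ≤ N := by
        have : (b : ℝ) * m ≤ b * (k * m) :=
          mul_le_mul_of_nonneg_left (le_mul_of_one_le_left hm0 (by linarith)) hb0.le
        linarith
      have h2 : δ ^ 2 / 64 * m ≤ Real.log n := by
        refine le_of_mul_le_mul_right ?_ hN0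
        calc δ ^ 2 / 64 * m * N = δ ^ 2 / 64 * N * m := by ring
          _ ≤ b * Real.log n * m := by gcongr
          _ = Real.log n * (b * m) := by ring
          _ ≤ Real.log n * N := by gcongr
      have h3 : δ ^ 2 / 64 * m ≤ δ ^ 2 / 64 * (δ / 8 * N) := by
        calc _ ≤ δ / 8 * (δ ^ 2 / 64) * n := h2.trans hlogn
          _ ≤ δ / 8 * (δ ^ 2 / 64) * N := by gcongr
          _ = _ := by ring
      exact le_of_mul_le_mul_left h3 (by positivity)

/-! ### Breaker's win -/

theorem le_sum_div_of_le_log {b s D : ℕ} (hs : 1 ≤ s) (h : (D : ℝ) + s ≤ b * Real.log s) :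
    D ≤ ∑ j ∈ Finset.range (s - 1), b / (j + 1) := by
  have h1 := log_add_one_le_harmonic (s - 1)
  rw [Nat.sub_add_cancel hs, harmonic] at h1
  push_cast at h1
  have h2 : ∀ j ∈ Finset.range (s - 1), (b : ℝ) * ((j : ℝ) + 1)⁻¹ - 1 ≤ (b / (j + 1) : ℕ) := by
    intro j _
    have := (Nat.lt_floor_add_one ((b : ℝ) / ((j + 1 : ℕ) : ℝ))).le
    rw [Nat.floor_div_eq_div] at this
    push_cast at this ⊢
    rw [← div_eq_mul_inv]
    linarith
  have h3 := Finset.sum_le_sum h2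
  rw [Finset.sum_sub_distrib, ← Finset.mul_sum, Finset.sum_const, Finset.card_range, nsmul_eq_mul,
    mul_one, Nat.cast_sub hs, ← Nat.cast_sum] at h3
  have h4 := mul_le_mul_of_nonneg_left h1 (Nat.cast_nonneg (α := ℝ) b)
  have h5 : (D : ℝ) ≤ (∑ j ∈ Finset.range (s - 1), b / (j + 1) : ℕ) := by
    push_cast at *
    linarith
  exact_mod_cast h5

theorem breakerWinsMinDegree_of_boxes {n k b m s : ℕ} (hk : 2 ≤ k) (hn : k ≤ n) (hm : 1 ≤ m)
    (hks : 2 * k ≤ s) (hsn : 2 * s ≤ n) (hpairs : 16 * (k : ℝ) ^ 2 * s * n.choose (k - 1) ≤ b * n)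
    (hbox : (n.choose (k - 1) : ℝ) + s ≤ b * Real.log s) : BreakerWinsMinDegree n k b m := by
  have hc := codegree_upper_bound hk hn
  have hn0 : (0 : ℝ) < n := by exact_mod_cast (by omega : 0 < n)
  obtain ⟨U, -, hU⟩ := Finset.exists_subset_card_eq
    (show 2 * s ≤ (Finset.univ : Finset (Fin n)).card by simpa using hsn)
  refine breakerWins_of_boxes (k := k) (s := s) (T := s / k) (D := (n - 1).choose (k - 1)) (U := U)
    hm (by omega) (fun f hf => (card_of_mem_completeHypergraph hf).le)
    (fun v => (hyperDegree_completeHypergraph (by omega) v).le) ?_ ?_ ?_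
  · refine (Nat.choose_le_choose _ (Nat.sub_le _ _)).trans (le_sum_div_of_le_log (by omega) hbox)
  · have := Nat.mul_div_le s k
    omega
  · refine (card_filter_two_le_inter_le
      (fun u v huv => (card_filter_pair_completeHypergraph hk huv).le) U).trans ?_
    rw [hU]
    set c := (n - 2).choose (k - 2)
    have h1 : 8 * k * s * c ≤ b := by
      have : (8 * k * s * c : ℝ) ≤ b := by
        refine le_of_mul_le_mul_right ?_ hn0
        calc (8 * k * s * c : ℝ) * n = 8 * k * s * (c * n) := by ring
          _ ≤ 8 * k * s * (2 * k * n.choose (k - 1)) := by gcongr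
          _ = 16 * (k : ℝ) ^ 2 * s * n.choose (k - 1) := by ring
          _ ≤ _ := hpairs
      exact_mod_cast this
    have h2 : s ≤ 2 * k * (s / k) := by
      have h3 := Nat.div_add_mod s k
      have h4 := Nat.mod_lt s (by omega : 0 < k)
      nlinarith
    calc (2 * s) ^ 2 * c = 4 * s * c * s := by ring
      _ ≤ 4 * s * c * (2 * k * (s / k)) := by gcongr
      _ = 8 * k * s * c * (s / k) := by ring
      _ ≤ b * (s / k) := by gcongr

theorem eventually_breakerWinsMinDegree {k : ℕ} (hk : 2 ≤ k) {ε : ℝ} (hε : 0 < ε) :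
    ∀ᶠ n : ℕ in atTop, ∀ m b : ℕ, 1 ≤ m →
      (1 + ε) * n.choose (k - 1) ≤ (b : ℝ) * Real.log n → BreakerWinsMinDegree n k b m := by
  have hk2 : (2 : ℝ) ≤ k := by exact_mod_cast hk
  -- Breaker plays on about `n ^ α` vertices, where `(1 + ε) * α = 1 + ε / 2`.
  set α : ℝ := (2 + ε) / (2 * (1 + ε)) with hα
  have hα0 : 0 < α := by positivity
  have hα1 : 0 < 1 - α := by
    rw [hα, sub_pos, div_lt_one (by positivity)]
    linarith
  have hεα : (1 + ε) * α = 1 + ε / 2 := by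
    rw [hα]
    field_simp
  set ρ : ℝ := min (1 / (32 * (k : ℝ) ^ 2)) (ε / 4) with hρ
  have hρ0 : 0 < ρ := by positivity
  have hpow : Tendsto (fun n : ℕ => (n : ℝ) ^ α) atTop atTop :=
    (tendsto_rpow_atTop hα0).comp tendsto_natCast_atTop_atTop
  filter_upwards [eventually_ge_atTop k, eventually_const_le_mul_log 1 one_pos,
    eventually_log_le_mul_rpow hρ0 hα1, hpow.eventually_ge_atTop (2 * k)]
    with n hn hlog1 hlogn hkn m b hm hb
  have hN := cast_le_choose_pred hk hn
  have hn0 : (0 : ℝ) < n := by exact_mod_cast (by omega : 0 < n)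
  set N : ℝ := ((n.choose (k - 1) : ℕ) : ℝ)
  have hN0 : 0 < N := hn0.trans_le hN
  rw [one_mul] at hlog1
  set s : ℕ := ⌈(n : ℝ) ^ α⌉₊ with hs
  have hs1 : (n : ℝ) ^ α ≤ s := Nat.le_ceil _
  have hs2 : (s : ℝ) ≤ 2 * (n : ℝ) ^ α := by
    have := (Nat.ceil_lt_add_one (Real.rpow_nonneg hn0.le α)).le
    rw [← hs] at this
    linarith
  have hs0 : (0 : ℝ) < s := (Real.rpow_pos_of_pos hn0 α).trans_le hs1
  have hslog : (s : ℝ) * Real.log n ≤ 2 * ρ * n := by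
    calc (s : ℝ) * Real.log n ≤ 2 * (n : ℝ) ^ α * (ρ * (n : ℝ) ^ (1 - α)) := by gcongr
      _ = 2 * ρ * ((n : ℝ) ^ α * (n : ℝ) ^ (1 - α)) := by ring
      _ = 2 * ρ * n := by
        rw [← Real.rpow_add hn0, add_sub_cancel, Real.rpow_one]
  have hsn : (s : ℝ) ≤ 2 * ρ * n := (le_mul_of_one_le_right hs0.le hlog1).trans hslog
  have hρk : 32 * (k : ℝ) ^ 2 * ρ ≤ 1 := by
    have := min_le_left (1 / (32 * (k : ℝ) ^ 2)) (ε / 4)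
    rw [← hρ, le_div_iff₀ (by positivity)] at this
    linarith
  have hρε : ρ ≤ ε / 4 := min_le_right _ _
  refine breakerWinsMinDegree_of_boxes (s := s) hk hn hm ?_ ?_ ?_ ?_
  · exact_mod_cast hkn.trans hs1
  · have hk4 : (4 : ℝ) ≤ (k : ℝ) ^ 2 := by nlinarith
    have hρ4 : 4 * ρ ≤ 1 := by nlinarith
    have : (2 * s : ℝ) ≤ n := by nlinarith
    exact_mod_cast this
  · have hlogpos : 0 < Real.log n := by linarith
    refine le_of_mul_le_mul_right ?_ hlogpos
    calc 16 * (k : ℝ) ^ 2 * s * N * Real.log n = 16 * (k : ℝ) ^ 2 * N * (s * Real.log n) := by ring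
      _ ≤ 16 * (k : ℝ) ^ 2 * N * (2 * ρ * n) := by gcongr
      _ = 32 * (k : ℝ) ^ 2 * ρ * (N * n) := by ring
      _ ≤ 1 * (N * n) := by gcongr
      _ ≤ (1 + ε) * N * n := by nlinarith [mul_pos hN0 hn0, mul_pos hε (mul_pos hN0 hn0)]
      _ ≤ b * Real.log n * n := by gcongr
      _ = b * n * Real.log n := by ring
  · have h1 : α * Real.log n ≤ Real.log s := by
      rw [← Real.log_rpow hn0]
      exact Real.log_le_log (Real.rpow_pos_of_pos hn0 α) hs1
    have h2 : (s : ℝ) ≤ ε / 2 * N := by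
      calc (s : ℝ) ≤ 2 * ρ * n := hsn
        _ ≤ 2 * (ε / 4) * N := by gcongr
        _ = ε / 2 * N := by ring
    calc N + s ≤ (1 + ε / 2) * N := by linarith
      _ = α * ((1 + ε) * N) := by rw [← hεα]; ring
      _ ≤ α * (b * Real.log n) := by gcongr
      _ = b * (α * Real.log n) := by ring
      _ ≤ b * Real.log s := by gcongr

theorem makerWinsMinDegree_of_bias_zero {n k m : ℕ} (hk : 2 ≤ k)
    (h : m ≤ (n - 1).choose (k - 1)) : MakerWinsMinDegree n k 0 m :=
  MakerWinsFrom.of_bias_zero fun v => by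
    rwa [hyperDegree_completeHypergraph (by omega) v]

/-! ### The threshold bias -/

theorem theorem1 (k : ℕ) (hk : 2 ≤ k) (m : ℕ → ℕ) :
    ((fun n : ℕ => (m n : ℝ)) =o[atTop] (fun n : ℕ => Real.log (n : ℝ)) →
      ∀ ε : ℝ, 0 < ε → ∀ᶠ n : ℕ in atTop, ∀ (b : ℕ) (β : ℝ),
        (b : ℝ) = β * (n.choose (k - 1) : ℝ) / Real.log (n : ℝ) →
          (β ≤ 1 - ε → MakerWinsMinDegree n k b (m n)) ∧
          (1 + ε ≤ β → 1 ≤ m n → BreakerWinsMinDegree n k b (m n))) ∧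
    ((fun n : ℕ => Real.log (n : ℝ)) =O[atTop] (fun n : ℕ => (m n : ℝ)) →
      ∀ γ : ℝ, γ < 1 → ∀ᶠ n : ℕ in atTop, ∀ b : ℕ, 1 ≤ b →
        (b : ℝ) ≤ γ * (n.choose (k - 1) : ℝ) / ((k : ℝ) * (m n : ℝ) + Real.log (n : ℝ)) →
          MakerWinsMinDegree n k b (m n)) := by
  have hk0 : (0 : ℝ) < k := by exact_mod_cast (by omega : 0 < k)
  constructor
  · intro hm ε hε
    set δ : ℝ := min (ε / 2) 1 with hδ
    have hδ0 : 0 < δ := by positivity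
    have hδε : δ ≤ ε / 2 := min_le_left _ _
    filter_upwards [eventually_ge_atTop k, eventually_const_le_mul_log 1 one_pos,
      eventually_makerWinsMinDegree hk hδ0 (min_le_right _ _),
      eventually_breakerWinsMinDegree hk hε, hm.bound (by positivity : 0 < ε / (2 * k)),
      hm.bound one_pos, eventually_const_le_mul_natCast k (by norm_num : (0 : ℝ) < 1 / 2),
      eventually_log_le_mul_rpow (by norm_num : (0 : ℝ) < 1 / 2) one_pos]
      with n hn hlog1 hmaker hbreaker hmε hmlog hkn hlogn b β hb
    rw [one_mul] at hlog1
    have hlog0 : 0 < Real.log n := by linarith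
    have hN := cast_le_choose_pred hk hn
    have hn0 : (0 : ℝ) < n := by exact_mod_cast (by omega : 0 < n)
    simp only [Real.norm_eq_abs, Nat.abs_cast, abs_of_pos hlog0] at hmε hmlog
    set N : ℝ := ((n.choose (k - 1) : ℕ) : ℝ)
    have hN0 : 0 < N := hn0.trans_le hN
    have hbβ : (b : ℝ) * Real.log n = β * N := by
      rw [hb, div_mul_cancel₀ _ hlog0.ne']
    refine ⟨fun hβ => ?_, fun hβ hm1 => hbreaker _ b hm1 ?_⟩
    · obtain rfl | hb1 := b.eq_zero_or_pos
      · refine makerWinsMinDegree_of_bias_zero hk ?_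
        have hD := degree_lower_bound hk hn hkn
        have : (m n : ℝ) ≤ (n - 1).choose (k - 1) := by
          rw [Real.rpow_one] at hlogn
          linarith
        exact_mod_cast this
      · refine hmaker (m n) b hb1 ?_
        have h1 : (k : ℝ) * m n ≤ ε / 2 * Real.log n := by
          calc (k : ℝ) * m n ≤ k * (ε / (2 * k) * Real.log n) := by gcongr
            _ = ε / 2 * Real.log n := by field_simp
        calc (b : ℝ) * (k * m n + Real.log n) ≤ b * (ε / 2 * Real.log n + Real.log n) := by gcongr
          _ = (1 + ε / 2) * (b * Real.log n) := by ring
          _ = (1 + ε / 2) * β * N := by rw [hbβ]; ring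
          _ ≤ (1 - δ) * N := by
            gcongr
            nlinarith
    · rw [hbβ]
      gcongr
  · intro _ γ hγ
    have hγ' : max γ 0 < 1 := max_lt hγ one_pos
    filter_upwards [eventually_const_le_mul_log 1 one_pos,
      eventually_makerWinsMinDegree hk (sub_pos.2 hγ') (by linarith [le_max_right γ 0])]
      with n hlog1 hmaker b hb hbound
    refine hmaker (m n) b hb ?_
    rw [one_mul] at hlog1
    rw [le_div_iff₀ (by positivity)] at hbound
    refine hbound.trans ?_
    rw [sub_sub_cancel]
    gcongr
    exact le_max_left _ _
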